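/- Let $l\ge 2$ and let $\mathrm{Dic}_l=\langle x,y \mid y^2=x^l,\ x^{2l}=1,\ y^{-1}xy=x^{-1}\rangle$ be the dicyclic group of order $4l$. Definitions. For a finite group $G$ with set $\mathrm{Irr}(G)$ of irreducible complex characters, put $\alpha(\theta,\varphi,\psi)=\theta(1)\varphi(1)\psi(1)\langle\theta\varphi\mid\psi\rangle$ for $\theta,\varphi,\psi\in\mathrm{Irr}(G)$, where $\langle\theta\mid\varphi\rangle=\frac1{|G|}\sum_{g\in G}\theta(g)\overline{\varphi(g)}$. A *character group* of $G$ is a group $Q$ of order $|G|$ together with a surjection $f\colon Q\to\mathrm{Irr}(G)$ such that $|f^{-1}\{\theta\}|=\theta(1)^2$ and $\alpha(\theta,\varphi,\psi)=|\{(a,b)\in f^{-1}\{\theta\}\times f^{-1}\{\varphi\} : f(ab)=\psi\}|$ for all $\theta,\varphi,\psi\in\mathrm{Irr}(G)$. It is *balanced* if, for all $\theta,\varphi\in\mathrm{Irr}(G)$, the number $|\{(a,b)\in f^{-1}\{\theta\}\times f^{-1}\{\varphi\} : ab=q\}|$ depends only on $f(q)$. Let $(Q,f)$ be a character group of $\mathrm{Dic}_l$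 and let $\omega\in\mathbb C$ be a primitive $2l$-th root of unity. Let $S_0\subseteq Q$ be the union of the fibres of $f$ over the two linear characters of $\mathrm{Dic}_l$ with $x\mapsto 1$. For $0<a<l$ let $S_a$ be the fibre over the irreducible character of degree $2$ with $x^i\mapsto\omega^{ai}+\omega^{-ai}$, and let $S_l$ be the union of the fibres over the two linear characters with $x\mapsto-1$. Let $x_0,y_0,x_1,y_1\in Q$ be such that $S_0=\{x_0,y_0\}$, $x_0y_0=y_0$ (so $x_0=e$ is the identity), and $S_1=\{x_0,y_0\}\cdot\{x_1,y_1\}$. (1) If $l$ is odd, then it is not the case that $x_1^2,\ x_1y_1\in\{x_0,y_0\}$ and $S_2=\{x_0,y_0\}\cdot\{y_1x_1,\,y_1^2\}$. (2) If $l$ is even, $(Q,f)$ is balanced, $x_1^2=e$, $x_1y_1=y_0$ and $y_1^2\notin\{x_0,y_0\}$, then $Q$ is isomorphic to the dihedral group $D_{2l}$ of order $4l$. -/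

import Mathlib

open scoped Pointwise

/-- The (complex) irreducible characters of a group `G`. -/
def IrrChar (G : Type*) [Group G] : Type _ :=
  {θ : G → ℂ // ∃ (n : ℕ) (ρ : Representation ℂ G (Fin n → ℂ)),
    ρ.IsIrreducible ∧ ρ.character = θ}

/-- The scalar product `⟨θ|φ⟩ = (1/|G|) ∑_g θ(g) conj(φ(g))` of functions on a finite group. -/
noncomputable def charInner {G : Type*} [Fintype G] (θ φ : G → ℂ) : ℂ :=
  (1 / (Fintype.card G : ℂ)) * ∑ g : G, θ g * starRingEnd ℂ (φ g)

/-- The weight `θ(1)²` of an irreducible character (a natural number, viewed in `ℂ`). -/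
def charWeight {G : Type*} [Group G] (θ : IrrChar G) : ℂ := (θ.1 1) ^ 2

/-- The multiplication function `α(θ₁,θ₂,θ₃) = θ₁(1) θ₂(1) θ₃(1) ⟨θ₁θ₂|θ₃⟩` of the weighted
character quasigroup (a natural number, viewed in `ℂ`). -/
noncomputable def charAlpha {G : Type*} [Group G] [Fintype G] (θ₁ θ₂ θ₃ : IrrChar G) : ℂ :=
  θ₁.1 1 * θ₂.1 1 * θ₃.1 1 * charInner (θ₁.1 * θ₂.1) θ₃.1

/-- `f : Q → IrrChar G` is a covering of the weighted character quasigroup of `G` by `Q`.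
When `Q` is a group, this says that `Q` is, by means of `f`, a character group of `G`.
No balancedness is required here. -/
structure IsCharCovering {G Q : Type*} [Group G] [Fintype G] [Mul Q]
    (f : Q → IrrChar G) : Prop where
  finite : Finite Q
  /-- the order of `Q` is the gross weight `∑ θ(1)² = |G|` -/
  card_eq : Nat.card Q = Fintype.card G
  surjective : Function.Surjective f
  weight : ∀ θ : IrrChar G, ((f ⁻¹' {θ}).ncard : ℂ) = charWeight θ
  mult : ∀ θ₁ θ₂ θ₃ : IrrChar G,
    (({p : Q × Q | p.1 ∈ f ⁻¹' {θ₁} ∧ p.2 ∈ f ⁻¹' {θ₂} ∧ f (p.1 * p.2) = θ₃}).ncard : ℂ)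
      = charAlpha θ₁ θ₂ θ₃

/-- The multiplicity `m_q(S,T)` of `q` in the product `S · T`. -/
noncomputable def prodMult {Q : Type*} [Mul Q] (S T : Set Q) (q : Q) : ℕ :=
  ({p : Q × Q | p.1 ∈ S ∧ p.2 ∈ T ∧ p.1 * p.2 = q}).ncard

/-- A map `f` is balanced if, for all `x, y, z`, the multiplicity of `q` in the product of the
fibres over `x` and `y` is the same for all `q` in the fibre over `z`. -/
def IsBalancedMap {X Q : Type*} [Mul Q] (f : Q → X) : Prop :=
  ∀ (x y : X) (q q' : Q), f q = f q' →
    prodMult (f ⁻¹' {x}) (f ⁻¹' {y}) q = prodMult (f ⁻¹' {x}) (f ⁻¹' {y}) q'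

/-- `QuaternionGroup l` is the dicyclic group `⟨x, y | y² = x^l, x^(2l) = 1, y⁻¹xy = x⁻¹⟩`, with
`x ^ i = QuaternionGroup.a i`.  The elements of the orbit `{s, -s}` of `s` under the action of
`y` on `ℤ/2l` (one element if `s = 0` or `s = l`, two otherwise) determine the restriction
`x ^ i ↦ ∑_{t ∈ {s, -s}} ω ^ (t i)`, where `ω` is a fixed primitive `2l`-th root of unity.
`dicS ω f s` is the union of the fibres of `f` over the irreducible characters of the dicyclic group
having this restriction to `⟨x⟩`: for `0 < s < l` it is the fibre of the one irreducible character
of degree two with values `ω ^ (s i) + ω ^ (-s i)` at `x ^ i`, while for `s = 0` and `s = l` it is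
the union of the two fibres over the linear characters with `x ↦ 1` and `x ↦ -1` respectively. -/
def dicS {l : ℕ} {Q : Type*} (ω : ℂ) (f : Q → IrrChar (QuaternionGroup l)) (s : ℕ) :
    Set Q :=
  {q | ∀ i : ZMod (2 * l), (f q).1 (QuaternionGroup.a i) =
    ∑ t ∈ ({(s : ZMod (2 * l)), -(s : ZMod (2 * l))} : Finset (ZMod (2 * l))),
      ω ^ (t * i).val}

/-- The choice of elements `x₀, y₀, x₁, y₁` for a covering of the dicyclic group:
`S₀ = {x₀, y₀}` with `x₀ y₀ = y₀`, and `S₁ = {x₀, y₀} · {x₁, y₁}`. -/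
structure IsDicChoice {l : ℕ} {Q : Type*} [Mul Q]
    (ω : ℂ) (f : Q → IrrChar (QuaternionGroup l)) (x₀ y₀ x₁ y₁ : Q) : Prop where
  S_zero : dicS ω f 0 = {x₀, y₀}
  mul_eq : x₀ * y₀ = y₀
  S_one : dicS ω f 1 = ({x₀, y₀} : Set Q) * {x₁, y₁}

/-- Case (b): `x₁², x₁y₁ ∈ {x₀, y₀}` and `S₂ = {x₀, y₀} · {y₁x₁, y₁²}`. -/
def DicCaseB {l : ℕ} {Q : Type*} [Mul Q]
    (ω : ℂ) (f : Q → IrrChar (QuaternionGroup l)) (x₀ y₀ x₁ y₁ : Q) : Prop :=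
  x₁ * x₁ ∈ ({x₀, y₀} : Set Q) ∧ x₁ * y₁ ∈ ({x₀, y₀} : Set Q) ∧
    dicS ω f 2 = ({x₀, y₀} : Set Q) * {y₁ * x₁, y₁ * y₁}

/-! Irreducible characters of the dicyclic group are grouped into layers `T a`, the constituents of
φ_a : x^i ↦ ω^(ai) + ω^(-ai) (zero off ⟨x⟩). Since φ_a φ_1 = φ_(a+1) + φ_(a-1), the product of an
element of `T a` with one of `T 1` lies in `T (a+1)` or `T (a-1)`, and `T (a+1)` is reached. The
layers with 0 ≤ a ≤ l are disjoint, and those with 0 < a < l have four elements.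

In both parts `x₁` is an involution with `y₁ = x₁ y`, where `T 0 = {1, y}` and y² = 1. Put r = x₁y.
Then y inverts r, and `T 1` = {r^(±1), r^(±1) y}. Induction gives r^a ∈ `T a`, and `T a` = {r^(±a),
r^(±a) y}, as long as these four elements stay distinct, that is, until r^(2b) = 1 for some 0 < b <
l (`IsDicLayering.pow_mem`).

For l odd, every p ∈ `T l` satisfies p² = y. If no such b exists, then r^l ∈ `T l` makes y a power
of r, which is impossible. Otherwise the least b gives an involution r^b ≠ y commuting with y, while
the Sylow 2-subgroups have order 4 and are cyclic because p has order 4: a contradiction.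

In the balanced case, if one element of a layer is a product from `T (a+1)` and `T 1`, all are. No
layer can then degenerate, r has order 2l, and Q = ⟨r, y⟩ is dihedral. -/

/-! ### Dihedral groups and involutions in groups of order 4l -/

section GroupTheory

variable {Q : Type*} [Group Q]

/-- A group of order `2n` with a cyclic subgroup `⟨r⟩` of order `n`, inverted by an involution
outside it, is dihedral. -/
theorem nonempty_mulEquiv_dihedralGroup {n : ℕ} [NeZero n] {r y : Q} (hr : orderOf r = n)
    (hy : y * y = 1) (hyr : y * r * y = r⁻¹) (hmem : y ∉ Subgroup.zpowers r)
    (hcard : Nat.card Q = 2 * n) : Nonempty (Q ≃* DihedralGroup n) := by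
  have hyinv : y⁻¹ = y := inv_eq_of_mul_eq_one_right hy
  let g : ZMod n → Q := fun i => r ^ i.val
  have gadd (i j : ZMod n) : g (i + j) = g i * g j := by
    simp only [g, ZMod.val_add, ← pow_add]
    rw [← pow_mod_orderOf r (i.val + j.val), hr]
  have gzero : g 0 = 1 := by simp [g]
  have gsub (i j : ZMod n) : g (j - i) = (g i)⁻¹ * g j := by
    rw [eq_inv_mul_iff_mul_eq, ← gadd, add_sub_cancel]
  have gcomm (i j : ZMod n) : g i * g j = g j * g i := by rw [← gadd, add_comm, gadd]
  have gconj (i : ZMod n) : g i * y = y * (g i)⁻¹ := by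
    have h : y * g i * y⁻¹ = (g i)⁻¹ := by
      simp only [g]
      rw [← conj_pow, hyinv, hyr, inv_pow]
    rw [← h, hyinv, ← mul_assoc, ← mul_assoc, hy, one_mul]
  let φ : DihedralGroup n →* Q :=
    { toFun := fun d => match d with
        | .r i => g i
        | .sr i => y * g i
      map_one' := gzero
      map_mul' := by
        rintro (i | i) (j | j)
        · exact gadd i j
        · change y * g (j - i) = g i * (y * g j)
          rw [gsub, ← mul_assoc, ← mul_assoc, gconj]
        · change y * g (i + j) = y * g i * g j
          rw [gadd, mul_assoc]
        · change g (j - i) = y * g i * (y * g j)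
          rw [gsub, mul_assoc, ← mul_assoc (g i), gconj, ← mul_assoc, ← mul_assoc, hy, one_mul] }
  have hinj : Function.Injective φ := by
    rw [injective_iff_map_eq_one]
    rintro (i | i) h
    · change r ^ i.val = 1 at h
      have h0 : i.val = 0 := by
        by_contra h0
        exact pow_ne_one_of_lt_orderOf h0 (hr ▸ ZMod.val_lt i) h
      rw [(ZMod.val_eq_zero i).1 h0]
      rfl
    · change y * r ^ i.val = 1 at h
      refine absurd ?_ hmem
      rw [eq_inv_of_mul_eq_one_left h]
      exact inv_mem (Subgroup.npow_mem_zpowers r _)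
  have hbij : Function.Bijective φ := by
    have : Finite Q := Nat.finite_of_card_ne_zero (by rw [hcard]; simp [NeZero.ne n])
    exact (Nat.bijective_iff_injective_and_card φ).2 ⟨hinj, by rw [DihedralGroup.nat_card, hcard]⟩
  exact ⟨(MulEquiv.ofBijective φ hbij).symm⟩

/-- In a group of order `4l`, `l` odd, with an element of order `4`, two commuting involutions
coincide. -/
theorem eq_of_commute_involutions {l : ℕ} (hl : Odd l) (hcard : Nat.card Q = 4 * l) {p y c : Q}
    (hp : orderOf p = 4) (hy : y * y = 1) (hy1 : y ≠ 1) (hc : c * c = 1) (hc1 : c ≠ 1)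
    (hyc : c * y = y * c) : c = y := by
  have : Finite Q := Nat.finite_of_card_ne_zero (by have := hl.pos; rw [hcard]; omega)
  have : Fact (Nat.Prime 2) := ⟨Nat.prime_two⟩
  have hsyl (P : Sylow 2 Q) : Nat.card P = 4 := by
    rw [P.card_eq_multiplicity, hcard, Nat.factorization_mul (by norm_num) hl.pos.ne']
    have h1 : Nat.factorization 4 2 = 2 := by
      rw [show 4 = 2 ^ 2 by norm_num, Nat.Prime.factorization_pow Nat.prime_two]; simp
    have h2 : l.factorization 2 = 0 :=
      Nat.factorization_eq_zero_of_not_dvd hl.not_two_dvd_nat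
    simp [h1, h2]
  have hP : IsPGroup 2 (Subgroup.zpowers p) :=
    IsPGroup.of_card (n := 2) (by rw [Nat.card_zpowers, hp]; norm_num)
  obtain ⟨P, hPle⟩ := hP.exists_le_sylow
  have hyinv : y⁻¹ = y := inv_eq_of_mul_eq_one_right hy
  have hcinv : c⁻¹ = c := inv_eq_of_mul_eq_one_right hc
  -- The commuting involutions generate a 2-group, which lies in some Sylow subgroup `R`.
  let K : Subgroup Q :=
    { carrier := {g | g = 1 ∨ g = y ∨ g = c ∨ g = c * y}
      one_mem' := Or.inl rfl
      mul_mem' := by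
        have e1 : y * (c * y) = c := by rw [hyc, ← mul_assoc, hy, one_mul]
        have e2 : c * (c * y) = y := by rw [← mul_assoc, hc, one_mul]
        have e3 : c * y * y = c := by rw [mul_assoc, hy, mul_one]
        have e4 : c * y * c = y := by rw [hyc, mul_assoc, hc, mul_one]
        have e5 : c * y * (c * y) = 1 := by rw [mul_assoc, e1, hc]
        rintro a b (rfl | rfl | rfl | rfl) (rfl | rfl | rfl | rfl) <;>
          simp [hy, hc, ← hyc, e1, e2, e3, e4, e5]
      inv_mem' := by
        rintro a (rfl | rfl | rfl | rfl) <;> simp [hyinv, hcinv, ← hyc] }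
  have hK : IsPGroup 2 K := by
    rintro ⟨g, hg⟩
    refine ⟨1, Subtype.ext ?_⟩
    have e5 : c * y * (c * y) = 1 := by
      rw [mul_assoc, hyc, ← mul_assoc y, hy, one_mul, hc]
    rcases hg with rfl | rfl | rfl | rfl <;> simp [pow_two, hy, hc, e5]
  obtain ⟨R, hRle⟩ := hK.exists_le_sylow
  -- `P` has order 4 and contains `p` of order 4; `R` is isomorphic to `P`, so it is cyclic too.
  have : IsCyclic P := by
    refine isCyclic_of_orderOf_eq_card (⟨p, hPle (Subgroup.mem_zpowers p)⟩ : P) ?_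
    rw [hsyl, Subgroup.orderOf_mk, hp]
  have : IsCyclic R := isCyclic_of_surjective (Sylow.equiv P R) (Sylow.equiv P R).surjective
  have hyR : y ∈ R := hRle (Or.inr (Or.inl rfl))
  have hcR : c ∈ R := hRle (Or.inr (Or.inr (Or.inl rfl)))
  by_contra hne
  classical
  have := Fintype.ofFinite R
  -- A cyclic group has at most two solutions of z² = 1, but 1, `y`, `c` would be three.
  have hle := IsCyclic.card_pow_eq_one_le (α := R) (n := 2) (by norm_num)
  have hsub : ({1, ⟨y, hyR⟩, ⟨c, hcR⟩} : Finset R) ⊆ Finset.univ.filter (fun a : R => a ^ 2 = 1) := by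
    intro z hz
    simp only [Finset.mem_insert, Finset.mem_singleton] at hz
    simp only [Finset.mem_filter, Finset.mem_univ, true_and]
    rcases hz with rfl | rfl | rfl
    · simp
    · exact Subtype.ext (by simpa [pow_two] using hy)
    · exact Subtype.ext (by simpa [pow_two] using hc)
  have h3 : ({1, ⟨y, hyR⟩, ⟨c, hcR⟩} : Finset R).card = 3 := by
    rw [Finset.card_eq_three]
    refine ⟨_, _, _, ?_, ?_, ?_, rfl⟩
    · exact fun h => hy1 (congrArg Subtype.val h).symm
    · exact fun h => hc1 (congrArg Subtype.val h).symm
    · exact fun h => hne (congrArg Subtype.val h).symm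
  have hle' := (Finset.card_le_card hsub).trans (le_of_eq_of_le (by congr!) hle)
  omega

/-! ### Layers of a dihedral group -/

/-- The elements `r ^ (± n)` and `r ^ (± n) * y`. -/
def dihedralLayer (r y : Q) (n : ℤ) : Set Q :=
  {g | ∃ m : ℤ, (m = n ∨ m = -n) ∧ (g = r ^ m ∨ g = r ^ m * y)}

theorem mul_zpow_of_conj {r y : Q} (hy : y * y = 1) (hyr : y * r * y = r⁻¹) (m : ℤ) :
    y * r ^ m = r ^ (-m) * y := by
  have hyinv : y⁻¹ = y := inv_eq_of_mul_eq_one_right hy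
  have h : y * r ^ m * y⁻¹ = r ^ (-m) := by
    rw [← conj_zpow, hyinv, hyr, inv_zpow']
  rw [← h, inv_mul_cancel_right]

/-- Moving `y` past a power of `r` only changes the sign of its exponent, so the exponent of the
product is ±n ± 1. -/
theorem mul_mem_dihedralLayer {r y : Q} (hy : y * y = 1) (hyr : y * r * y = r⁻¹) {n : ℤ} {p q : Q}
    (hp : p ∈ dihedralLayer r y n) (hq : q ∈ dihedralLayer r y 1) :
    p * q ∈ dihedralLayer r y (n + 1) ∨ p * q ∈ dihedralLayer r y (n - 1) := by
  obtain ⟨m, hm, hp⟩ := hp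
  obtain ⟨k, hk, hq⟩ := hq
  suffices h : ∃ j : ℤ, (j = m + k ∨ j = m - k) ∧ (p * q = r ^ j ∨ p * q = r ^ j * y) by
    obtain ⟨j, hj, h⟩ := h
    by_cases hjn : j = n + 1 ∨ j = -(n + 1)
    · exact Or.inl ⟨j, hjn, h⟩
    · exact Or.inr ⟨j, by omega, h⟩
  rcases hp with rfl | rfl
  · refine ⟨m + k, Or.inl rfl, ?_⟩
    rcases hq with rfl | rfl
    · exact Or.inl (zpow_add r m k).symm
    · exact Or.inr (by rw [zpow_add, mul_assoc])
  · refine ⟨m - k, Or.inr rfl, ?_⟩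
    rcases hq with rfl | rfl
    · exact Or.inr (by rw [mul_assoc, mul_zpow_of_conj hy hyr, ← mul_assoc, ← zpow_add, sub_eq_add_neg])
    · refine Or.inl ?_
      rw [mul_assoc, ← mul_assoc y, mul_zpow_of_conj hy hyr, mul_assoc, hy, mul_one, ← zpow_add,
        sub_eq_add_neg]

/-- The layer is the orbit of r^n under left and right multiplication by `y`, because y r^n y =
r^(-n). -/
theorem dihedralLayer_subset {r y : Q} (hy : y * y = 1) (hyr : y * r * y = r⁻¹) {n : ℤ} {S : Set Q}
    (hleft : ∀ q ∈ S, y * q ∈ S) (hright : ∀ q ∈ S, q * y ∈ S) (hmem : r ^ n ∈ S) :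
    dihedralLayer r y n ⊆ S := by
  have hneg : r ^ (-n) ∈ S := by
    have h := hright _ (hleft _ hmem)
    rwa [mul_zpow_of_conj hy hyr, mul_assoc, hy, mul_one] at h
  rintro g ⟨m, rfl | rfl, rfl | rfl⟩
  · exact hmem
  · exact hright _ hmem
  · exact hneg
  · exact hright _ hneg

theorem ncard_dihedralLayer {r y : Q} {n : ℤ} (hmem : y ∉ Subgroup.zpowers r)
    (hn : r ^ (2 * n) ≠ 1) : (dihedralLayer r y n).ncard = 4 := by
  have hset : dihedralLayer r y n = {r ^ n, r ^ (-n), r ^ n * y, r ^ (-n) * y} := by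
    ext g
    constructor
    · rintro ⟨m, rfl | rfl, rfl | rfl⟩ <;> simp
    · rintro (rfl | rfl | rfl | rfl)
      · exact ⟨_, Or.inl rfl, Or.inl rfl⟩
      · exact ⟨_, Or.inr rfl, Or.inl rfl⟩
      · exact ⟨_, Or.inl rfl, Or.inr rfl⟩
      · exact ⟨_, Or.inr rfl, Or.inr rfl⟩
  have h1 : r ^ n ≠ r ^ (-n) := fun h => hn (by
    rw [two_mul, zpow_add]; nth_rewrite 2 [h]; rw [← zpow_add, add_neg_cancel, zpow_zero])
  have h2 (i j : ℤ) : r ^ i ≠ r ^ j * y := fun h => hmem (by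
    rw [← inv_mul_eq_iff_eq_mul] at h
    rw [← h]
    exact mul_mem (inv_mem (Subgroup.zpow_mem_zpowers r _)) (Subgroup.zpow_mem_zpowers r _))
  rw [hset, Set.ncard_insert_of_notMem (by simp [-zpow_neg, h1, h2]),
    Set.ncard_insert_of_notMem (by
      simp only [Set.mem_insert_iff, Set.mem_singleton_iff, h2, or_self, not_false_iff]), Set.ncard_pair (by simpa using h1)]

theorem dihedralLayer_subset_pair {r y : Q} {n : ℤ} (hn : r ^ (2 * n) = 1) :
    dihedralLayer r y n ⊆ {r ^ n, r ^ n * y} := by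
  have h : r ^ (-n) = r ^ n := by
    rw [zpow_neg, inv_eq_iff_mul_eq_one, ← zpow_add, ← two_mul, hn]
  rintro g ⟨m, rfl | rfl, rfl | rfl⟩ <;> simp [h]

/-- A sequence of subsets of a group that multiply like the supports of the characters
`x ^ i ↦ ω ^ (a i) + ω ^ (-a i)` of a dicyclic group, the first two being built from two
involutions `x` and `y`. -/
structure IsDicLayering (l : ℕ) (x y : Q) (T : ℕ → Set Q) : Prop where
  two_le : 2 ≤ l
  zero : T 0 = {1, y}
  one : T 1 = ({1, y} : Set Q) * {x, x * y}
  y_ne : y ≠ 1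
  y_mul_y : y * y = 1
  x_mul_x : x * x = 1
  left : ∀ a, 0 < a → a < l → ∀ q ∈ T a, y * q ∈ T a
  right : ∀ a, 0 < a → a < l → ∀ q ∈ T a, q * y ∈ T a
  ncard : ∀ a, 0 < a → a < l → (T a).ncard = 4
  mul : ∀ a, a + 1 < l → ∀ p ∈ T (a + 1), ∀ q ∈ T 1, p * q ∈ T (a + 2) ∨ p * q ∈ T a
  exists_mul : ∀ a, a + 1 < l → ∃ p ∈ T (a + 1), ∃ q ∈ T 1, p * q ∈ T (a + 2)
  eq_of_mem : ∀ a b, a ≤ l → b ≤ l → ∀ q, q ∈ T a → q ∈ T b → a = b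

/-! ### Powers of r = xy in an abstract layering -/

namespace IsDicLayering

variable {l : ℕ} {x y : Q} {T : ℕ → Set Q} (h : IsDicLayering l x y T)
include h

theorem conj : y * (x * y) * y = (x * y)⁻¹ := by
  rw [mul_inv_rev, inv_eq_of_mul_eq_one_right h.x_mul_x, inv_eq_of_mul_eq_one_right h.y_mul_y,
    mul_assoc, mul_assoc, h.y_mul_y, mul_one]

theorem left_mem {a : ℕ} (ha : a < l) {q : Q} (hq : q ∈ T a) : y * q ∈ T a := by
  rcases Nat.eq_zero_or_pos a with rfl | h0
  · rw [h.zero] at hq ⊢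
    rcases hq with rfl | rfl <;> simp [h.y_mul_y]
  · exact h.left a h0 ha q hq

theorem right_mem {a : ℕ} (ha : a < l) {q : Q} (hq : q ∈ T a) : q * y ∈ T a := by
  rcases Nat.eq_zero_or_pos a with rfl | h0
  · rw [h.zero] at hq ⊢
    rcases hq with rfl | rfl <;> simp [h.y_mul_y]
  · exact h.right a h0 ha q hq

theorem layer_subset {a : ℕ} (ha : a < l) {n : ℤ} (hn : (x * y) ^ n ∈ T a) :
    dihedralLayer (x * y) y n ⊆ T a :=
  dihedralLayer_subset h.y_mul_y h.conj (fun _ => h.left_mem ha) (fun _ => h.right_mem ha) hn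

theorem mem_one : x * y ∈ T 1 := by
  rw [h.one]
  exact ⟨1, by simp, x * y, by simp, one_mul _⟩

theorem one_eq : T 1 = dihedralLayer (x * y) y 1 := by
  refine Set.Subset.antisymm ?_ (h.layer_subset h.two_le (by simpa using h.mem_one))
  have e1 : (x * y) * y = x := by rw [mul_assoc, h.y_mul_y, mul_one]
  have e2 : (x * y)⁻¹ = y * x := by
    rw [mul_inv_rev, inv_eq_of_mul_eq_one_right h.x_mul_x, inv_eq_of_mul_eq_one_right h.y_mul_y]
  rw [h.one]
  rintro _ ⟨a, (rfl | rfl), b, (rfl | rfl), rfl⟩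
  · exact ⟨1, by simp, Or.inr (by simp [e1])⟩
  · exact ⟨1, by simp, Or.inl (by simp)⟩
  · exact ⟨-1, by simp, Or.inl (by simp [-mul_inv_rev, e2])⟩
  · exact ⟨-1, by simp, Or.inr (by simp [-mul_inv_rev, e2, mul_assoc])⟩

/-- Otherwise r^a = r^(-a) and the dihedral layer has at most two elements, too few to contain the
four of `T a`. -/
theorem zpow_two_ne {a : ℕ} (h0 : 0 < a) (ha : a < l) (hT : T a ⊆ dihedralLayer (x * y) y a) :
    (x * y) ^ (2 * (a : ℤ)) ≠ 1 := by
  intro h2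
  have hc := Set.ncard_le_ncard (hT.trans (dihedralLayer_subset_pair h2)) (Set.toFinite _)
  rw [h.ncard a h0 ha] at hc
  have := hc.trans (Set.ncard_insert_le _ _)
  rw [Set.ncard_singleton] at this
  omega

theorem sq_ne : (x * y) ^ 2 ≠ 1 := by
  have := h.zpow_two_ne one_pos h.two_le (by rw [h.one_eq]; simp)
  exact_mod_cast this

/-- A power of r commutes with r, whereas `y` inverts r; both together would give r² = 1. -/
theorem notMem_zpowers : y ∉ Subgroup.zpowers (x * y) := by
  rintro ⟨m, hm⟩
  have hcomm : y * (x * y) = (x * y) * y := by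
    have := (Commute.refl (x * y)).zpow_left m
    simp only at hm
    rw [hm] at this
    exact this
  apply h.sq_ne
  rw [pow_two, mul_eq_one_iff_eq_inv, ← h.conj, hcomm, mul_assoc, h.y_mul_y, mul_one]

theorem eq_layer {a : ℕ} (h0 : 0 < a) (ha : a < l) (hmem : (x * y) ^ a ∈ T a)
    (hne : (x * y) ^ (2 * a) ≠ 1) : T a = dihedralLayer (x * y) y a := by
  refine (Set.eq_of_subset_of_ncard_le (h.layer_subset ha (by exact_mod_cast hmem)) ?_ ?_).symm
  · rw [h.ncard a h0 ha, ncard_dihedralLayer h.notMem_zpowers (by exact_mod_cast hne)]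
  · exact Set.finite_of_ncard_ne_zero (by rw [h.ncard a h0 ha]; norm_num)

/-- Two-step induction. Below the first degeneration `T (a+1)` is a full dihedral layer, so if
r^(a+2) fell back into `T a`, all of `T (a+1) * T 1` would, and `T (a+2)` would never be reached.
Only exponents b < a need be nondegenerate, so a = l is allowed. -/
theorem pow_mem (a : ℕ) (ha : a ≤ l) (hne : ∀ b, 0 < b → b < a → (x * y) ^ (2 * b) ≠ 1) :
    (x * y) ^ a ∈ T a := by
  induction a using Nat.twoStepInduction with
  | zero => simp [h.zero]
  | one => simpa using h.mem_one
  | more a ih0 ih1 =>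
    have m0 := ih0 (by omega) (fun b hb hb' => hne b hb (by omega))
    have m1 := ih1 (by omega) (fun b hb hb' => hne b hb (by omega))
    have heq := h.eq_layer (Nat.succ_pos a) (by omega) m1 (hne _ (Nat.succ_pos a) (by omega))
    by_contra hnot
    have m2 : (x * y) ^ (a + 2) ∈ T a := by
      have := h.mul a (by omega) _ m1 _ h.mem_one
      rw [← pow_succ] at this
      exact this.resolve_left hnot
    obtain ⟨p, hp, q, hq, hpq⟩ := h.exists_mul a (by omega)
    rw [heq] at hp
    rw [h.one_eq] at hq
    have hpq' : p * q ∈ T a := by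
      rcases mul_mem_dihedralLayer h.y_mul_y h.conj hp hq with h' | h'
      · exact h.layer_subset (by omega) (by exact_mod_cast m2) h'
      · refine h.layer_subset (by omega) ?_ h'
        simpa using m0
    have := h.eq_of_mem _ _ ha (by omega) _ hpq hpq'
    omega

theorem false_of_odd (hodd : Odd l) (hcard : Nat.card Q = 4 * l)
    (hp : ∀ p ∈ T l, p * p = y) (hT : (T l).Nonempty) : False := by
  by_cases hex : ∃ b, 0 < b ∧ b < l ∧ (x * y) ^ (2 * b) = 1
  · classical
    obtain ⟨hb0, hbl, hb⟩ := Nat.find_spec hex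
    have hmin := fun {m} => Nat.find_min hex (m := m)
    set b := Nat.find hex
    have hmem := h.pow_mem b hbl.le (fun c hc hcb hcc => hmin hcb ⟨hc, hcb.trans hbl, hcc⟩)
    -- Disjointness from `T 0` says that r^b is neither 1 nor `y`; since r^(2b) = 1 it is an
    -- involution, and it commutes with `y`.
    have hnot : (x * y) ^ b ∉ T 0 := fun h' => by
      have := h.eq_of_mem _ _ hbl.le (Nat.zero_le l) _ hmem h'
      omega
    rw [h.zero] at hnot
    simp only [Set.mem_insert_iff, Set.mem_singleton_iff, not_or] at hnot
    obtain ⟨p, hpT⟩ := hT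
    have hpp := hp p hpT
    have hp4 : orderOf p = 4 := by
      refine orderOf_eq_prime_pow (p := 2) (n := 1) ?_ ?_
      · rw [pow_one, pow_two, hpp]; exact h.y_ne
      · rw [show (2 : ℕ) ^ (1 + 1) = 2 * 2 by norm_num, pow_mul, pow_two p, hpp, pow_two, h.y_mul_y]
    refine hnot.2 (eq_of_commute_involutions hodd hcard hp4 h.y_mul_y h.y_ne ?_ hnot.1 ?_)
    · rw [← pow_add, ← two_mul, hb]
    · have h1 := mul_zpow_of_conj h.y_mul_y h.conj (b : ℤ)
      rw [zpow_neg, zpow_natCast] at h1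
      rw [h1]
      congr 1
      rw [eq_inv_iff_mul_eq_one, ← pow_add, ← two_mul, hb]
  · push Not at hex
    have hmem := h.pow_mem l le_rfl (fun b => hex b)
    apply h.notMem_zpowers
    have h1 := Subgroup.npow_mem_zpowers (x * y) (l + l)
    rwa [pow_add, hp _ hmem] at h1

/-- The hypothesis `hbal` is the only trace of balancedness: it spreads being a product from `T
(a+1)` and `T 1` from r^(a+2) to its whole layer. -/
theorem nonempty_mulEquiv (hcard : Nat.card Q = 4 * l)
    (hbal : ∀ a, a + 2 < l → ∀ q ∈ T (a + 2), ∀ q' ∈ T (a + 2),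
      (∃ s ∈ T (a + 1), ∃ t ∈ T 1, s * t = q) → ∃ s ∈ T (a + 1), ∃ t ∈ T 1, s * t = q') :
    Nonempty (Q ≃* DihedralGroup (2 * l)) := by
  have hl := h.two_le
  have hne : ∀ b, 0 < b → b < l → (x * y) ^ (2 * b) ≠ 1 := by
    intro b
    induction b using Nat.strong_induction_on with
    | _ b ih =>
    intro hb0 hbl hb
    obtain ⟨a, rfl⟩ : ∃ a, b = a + 2 := by
      rcases b with _ | _ | a
      · omega
      · exact absurd hb h.sq_ne
      · exact ⟨a, rfl⟩
    have hpow : ∀ c ≤ a + 2, (x * y) ^ c ∈ T c := fun c hc =>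
      h.pow_mem c (by omega) (fun d hd hdc => ih d (by omega) hd (by omega))
    have heq := h.eq_layer (Nat.succ_pos a) (by omega) (hpow (a + 1) (by omega))
      (ih _ (by omega) (by omega) (by omega))
    -- It suffices to place `T (a+2)` inside the dihedral layer: each element is a product of
    -- dihedral layers a+1 and 1, and the alternative layer a lies in `T a`, disjoint from `T
    -- (a+2)`.
    refine h.zpow_two_ne hb0 hbl ?_ (by exact_mod_cast hb)
    intro q' hq'
    obtain ⟨s, hs, t, ht, rfl⟩ := hbal a hbl _ (hpow (a + 2) le_rfl) q' hq'
      ⟨_, hpow (a + 1) (by omega), _, h.mem_one, (pow_succ _ _).symm⟩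
    rw [heq] at hs
    rw [h.one_eq] at ht
    rcases mul_mem_dihedralLayer h.y_mul_y h.conj hs ht with h' | h'
    · convert! h' using 1
    · have h1 : s * t ∈ T a := by
        refine h.layer_subset (by omega) ?_ h'
        simpa using hpow a (by omega)
      have := h.eq_of_mem _ _ hbl.le (by omega) _ hq' h1
      omega
  have hpow : ∀ c ≤ l, (x * y) ^ c ∈ T c := fun c hc =>
    h.pow_mem c hc (fun d hd hdc => hne d hd (by omega))
  have : Finite Q := Nat.finite_of_card_ne_zero (by rw [hcard]; omega)
  have hge : 2 * l ≤ orderOf (x * y) := by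
    by_contra hlt
    push Not at hlt
    have hk1 := pow_orderOf_eq_one (x * y)
    have hk0 := orderOf_pos (x * y)
    set k := orderOf (x * y)
    -- An order k < 2l makes two layers meet: if k ≤ l, then 1 = r^k lies in `T k` and `T 0`;
    -- otherwise r^l = r^(-(k-l)) lies in `T l` and `T (k-l)`.
    by_cases hkl : k ≤ l
    · have := h.eq_of_mem _ 0 hkl (Nat.zero_le l) _ (hpow k hkl) (by rw [hk1, h.zero]; simp)
      omega
    · have h1 : (x * y) ^ (k - l) ∈ T (k - l) := hpow _ (by omega)
      have h2 : (x * y) ^ l ∈ T (k - l) := by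
        refine h.layer_subset (n := ((k - l : ℕ) : ℤ)) (by omega) (by exact_mod_cast h1)
          ⟨_, Or.inr rfl, Or.inl ?_⟩
        rw [Nat.cast_sub (by omega), neg_sub, zpow_sub, zpow_natCast, zpow_natCast, hk1, inv_one,
          mul_one]
      have := h.eq_of_mem _ _ (by omega) le_rfl _ h2 (hpow l le_rfl)
      omega
  have horder : orderOf (x * y) = 2 * l := by
    -- The index d of ⟨r⟩ is not 1 because `y` is outside, so the order is at most 4l/2.
    obtain ⟨d, hd⟩ := orderOf_dvd_natCard (x * y)
    rw [hcard] at hd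
    have hd1 : d ≠ 1 := by
      rintro rfl
      apply h.notMem_zpowers
      have htop : Subgroup.zpowers (x * y) = ⊤ := by
        apply Subgroup.eq_top_of_card_eq
        rw [Nat.card_zpowers, hcard, hd, mul_one]
      rw [htop]
      trivial
    have hd0 : d ≠ 0 := by rintro rfl; omega
    have : orderOf (x * y) * 2 ≤ orderOf (x * y) * d := Nat.mul_le_mul_left _ (by omega)
    omega
  have : NeZero (2 * l) := ⟨by omega⟩
  exact nonempty_mulEquiv_dihedralGroup horder h.y_mul_y h.conj h.notMem_zpowers
    (by rw [hcard]; ring)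

end IsDicLayering

end GroupTheory

/-! ### Orthogonality and construction of irreducible characters -/

section Characters

theorem IrrChar.ext_iff {G : Type*} [Group G] {θ ψ : IrrChar G} : θ = ψ ↔ θ.1 = ψ.1 :=
  Subtype.ext_iff

theorem charInner_add_left {G : Type*} [Fintype G] (θ φ ψ : G → ℂ) :
    charInner (θ + φ) ψ = charInner θ ψ + charInner φ ψ := by
  simp only [charInner, Pi.add_apply, add_mul, Finset.sum_add_distrib, mul_add]

-- The hypothesis turns the complex conjugate of the scalar product into the sum with θ(g⁻¹), to
-- which Schur orthogonality applies.
open scoped Classical in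
theorem charInner_irrChar {G : Type*} [Group G] [Fintype G] {θ : IrrChar G} (ψ : IrrChar G)
    (hθ : ∀ g, starRingEnd ℂ (θ.1 g) = θ.1 g⁻¹) :
    charInner θ.1 ψ.1 = if θ = ψ then 1 else 0 := by
  obtain ⟨_, m, σ, hσ, rfl⟩ := θ
  have hcard : (Nat.card G : ℂ) ≠ 0 := by simp
  let _ := invertibleOfNonzero hcard
  have hconj (ψ : G → ℂ) : starRingEnd ℂ (charInner σ.character ψ) =
      (Nat.card G : ℂ)⁻¹ * ∑ g : G, ψ g * σ.character g⁻¹ := by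
    simp only [charInner, map_mul, map_sum, one_div, map_inv₀, map_natCast, Nat.card_eq_fintype_card,
      Complex.conj_conj]
    congr 1
    exact Finset.sum_congr rfl fun g _ => by rw [hθ g, mul_comm]
  apply (starRingEnd ℂ).injective
  rw [hconj]
  split_ifs with h
  · rw [← h, Representation.char_orthonormal σ σ, if_pos ⟨Representation.Equiv.refl σ⟩, map_one]
  · obtain ⟨_, n, ρ, hρ, rfl⟩ := ψ
    rw [Representation.char_orthonormal ρ σ, if_neg, map_zero]
    rintro ⟨φ⟩
    exact h (Subtype.ext (Representation.char_iso φ))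

theorem isIrreducible_of_forall_eq_top {G V : Type*} [Group G] [AddCommGroup V] [Module ℂ V]
    [Nontrivial V] (ρ : Representation ℂ G V)
    (h : ∀ W : Submodule ℂ V, (∀ g, ∀ v ∈ W, ρ g v ∈ W) → ∀ v ∈ W, v ≠ 0 → W = ⊤) :
    ρ.IsIrreducible where
  exists_pair_ne := ⟨⊥, ⊤, fun hbt => by
    have : (⊥ : Submodule ℂ V) = ⊤ := congrArg Subrepresentation.toSubmodule hbt
    exact bot_ne_top this⟩
  eq_bot_or_eq_top p := by
    by_cases hp : p.toSubmodule = ⊥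
    · exact Or.inl (Subrepresentation.toSubmodule_injective hp)
    · obtain ⟨v, hv, hv0⟩ := Submodule.exists_mem_ne_zero_of_ne_bot hp
      exact Or.inr (Subrepresentation.toSubmodule_injective
        (h _ (fun g _ hw => p.apply_mem_toSubmodule g hw) v hv hv0))

/-- The representation given by a homomorphism to matrices. -/
noncomputable def matrixRep {G : Type*} [Group G] {n : ℕ} (μ : G →* Matrix (Fin n) (Fin n) ℂ) :
    Representation ℂ G (Fin n → ℂ) :=
  (Matrix.toLinAlgEquiv' : Matrix (Fin n) (Fin n) ℂ ≃ₐ[ℂ] _).toMonoidHom.comp μ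

theorem matrixRep_apply {G : Type*} [Group G] {n : ℕ} (μ : G →* Matrix (Fin n) (Fin n) ℂ) (g : G)
    (v : Fin n → ℂ) : matrixRep μ g v = (μ g).mulVec v := rfl

theorem matrixRep_character {G : Type*} [Group G] {n : ℕ} (μ : G →* Matrix (Fin n) (Fin n) ℂ) :
    (matrixRep μ).character = fun g => (μ g).trace := by
  ext g
  exact Matrix.trace_toLin'_eq (μ g)

theorem exists_irrChar_of_monoidHom {G : Type*} [Group G] (χ : G →* ℂ) :
    ∃ θ : IrrChar G, θ.1 = χ := by
  let μ : G →* Matrix (Fin 1) (Fin 1) ℂ := (Matrix.scalar (Fin 1)).toMonoidHom.comp χ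
  refine ⟨⟨_, 1, matrixRep μ, isIrreducible_of_forall_eq_top _ ?_, rfl⟩, ?_⟩
  · intro W _ v hv hv0
    rw [Submodule.eq_top_iff']
    intro w
    have hv1 : v 0 ≠ 0 := fun h0 => hv0 (by ext i; fin_cases i; exact h0)
    have : w = (w 0 / v 0) • v := by
      ext i
      fin_cases i
      simp [hv1]
    rw [this]
    exact W.smul_mem _ hv
  · change (matrixRep μ).character = χ
    rw [matrixRep_character]
    ext g
    simp [μ, Matrix.trace]

/-! ### Characters of the dicyclic group -/

namespace QuaternionGroup

variable {l : ℕ} (e : AddChar (ZMod (2 * l)) ℂ)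

theorem natCast_add_natCast : (l : ZMod (2 * l)) + l = 0 := by
  rw [← two_mul]
  exact_mod_cast ZMod.natCast_self (2 * l)

/-- The function `x ^ i ↦ e (s i)`, `y x ^ i ↦ c e (s i)`. -/
noncomputable def linFun (s : ZMod (2 * l)) (c : ℂ) : QuaternionGroup l → ℂ
  | .a i => e (s * i)
  | .xa i => c * e (s * i)

/-- The function `x ^ i ↦ e (s i) + e (-s i)` vanishing outside `⟨x⟩`. -/
noncomputable def dihFun (s : ZMod (2 * l)) : QuaternionGroup l → ℂ
  | .a i => e (s * i) + e (-(s * i))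
  | .xa _ => 0

theorem addChar_neg_of_add_self {s : ZMod (2 * l)} (hs : s + s = 0) (i : ZMod (2 * l)) :
    e (-(s * i)) = e (s * i) := by
  rw [← neg_mul, neg_eq_of_add_eq_zero_left hs]

/-- A linear character of the dicyclic group. -/
noncomputable def linHom {s : ZMod (2 * l)} {c : ℂ} (hs : s + s = 0) (hc : c * c = e (s * l)) :
    QuaternionGroup l →* ℂ where
  toFun := linFun e s c
  map_one' := by
    change linFun e s c (.a 0) = 1
    simp [linFun]
  map_mul' := by
    rintro (i | i) (j | j)
    · simp [linFun, mul_add, AddChar.map_add_eq_mul]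
    · simp only [a_mul_xa, linFun, mul_add, mul_neg, sub_eq_add_neg, AddChar.map_add_eq_mul,
        addChar_neg_of_add_self e hs]
      ring
    · simp only [xa_mul_a, linFun, mul_add, AddChar.map_add_eq_mul]
      ring
    · simp only [xa_mul_xa, linFun, mul_add, mul_neg, sub_eq_add_neg, AddChar.map_add_eq_mul,
        addChar_neg_of_add_self e hs, ← hc]
      ring

theorem exists_linFun {s : ZMod (2 * l)} {c : ℂ} (hs : s + s = 0) (hc : c * c = e (s * l)) :
    ∃ θ : IrrChar (QuaternionGroup l), θ.1 = linFun e s c :=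
  exists_irrChar_of_monoidHom (linHom e hs hc)

theorem conj_linFun [NeZero l] {s : ZMod (2 * l)} {c : ℂ} (hs : s + s = 0) (hc : c * c = e (s * l))
    (g : QuaternionGroup l) : starRingEnd ℂ (linFun e s c g) = linFun e s c g⁻¹ := by
  have h : linFun e s c g * linFun e s c g⁻¹ = 1 := by
    change linHom e hs hc g * linHom e hs hc g⁻¹ = 1
    rw [← map_mul, mul_inv_cancel, map_one]
  have hn : ‖linFun e s c g‖ = 1 := by
    refine Complex.norm_eq_one_of_pow_eq_one (n := Fintype.card (QuaternionGroup l)) ?_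
      Fintype.card_ne_zero
    change (linHom e hs hc g) ^ _ = 1
    rw [← map_pow, pow_card_eq_one, map_one]
  rw [← Complex.inv_eq_conj hn, eq_comm]
  exact eq_inv_of_mul_eq_one_right h

/-- A homomorphism from the dicyclic group to `2 × 2` matrices. -/
noncomputable def dihHom (s : ZMod (2 * l)) :
    QuaternionGroup l →* Matrix (Fin 2) (Fin 2) ℂ where
  toFun
    | .a i => !![e (s * i), 0; 0, e (-(s * i))]
    | .xa i => !![0, e (s * l) * e (-(s * i)); e (s * i), 0]
  map_one' := by
    change !![e (s * 0), 0; 0, e (-(s * 0))] = 1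
    simp [Matrix.one_fin_two]
  map_mul' := by
    have hl : e (-(s * l)) = e (s * l) := by
      congr 1
      rw [neg_eq_iff_add_eq_zero, ← mul_add, natCast_add_natCast, mul_zero]
    rintro (i | i) (j | j)
    · simp [mul_add, AddChar.map_add_eq_mul, mul_comm]
    · simp [mul_add, sub_eq_add_neg, AddChar.map_add_eq_mul]
      constructor <;> ring
    · simp [mul_add, AddChar.map_add_eq_mul]
      ring
    · simp [mul_add, sub_eq_add_neg, AddChar.map_add_eq_mul, hl]
      exact ⟨by ring, Or.inl (by ring)⟩

theorem exists_dihFun {s : ZMod (2 * l)} (hs : e s ≠ e (-s)) :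
    ∃ θ : IrrChar (QuaternionGroup l), θ.1 = dihFun e s := by
  refine ⟨⟨_, 2, matrixRep (dihHom e s), isIrreducible_of_forall_eq_top _ ?_, rfl⟩, ?_⟩
  · intro W hW v hv hv0
    have key (u : Fin 2 → ℂ) (hu : u ∈ W) (hu0 : u 0 ≠ 0) : W = ⊤ := by
      -- The operator ρ(x) - e(-s) kills the second coordinate and scales the first by e(s) - e(-s)
      -- ≠ 0.
      have h1 : ![1, 0] ∈ W := by
        have h2 := W.smul_mem ((e s - e (-s)) * u 0)⁻¹
          (W.sub_mem (hW (.a 1) u hu) (W.smul_mem (e (-s)) hu))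
        convert! h2 using 1
        have hd := sub_ne_zero.2 hs
        ext i
        fin_cases i
        · simp [matrixRep_apply, dihHom, dotProduct, Matrix.vecHead]
          field_simp
        · simp [matrixRep_apply, dihHom, dotProduct, Matrix.vecHead, Matrix.vecTail]
      have h2 : ![0, 1] ∈ W := by
        convert! hW (.xa 0) _ h1 using 1
        ext i
        fin_cases i <;> simp [matrixRep_apply, dihHom]
      rw [Submodule.eq_top_iff']
      intro w
      have : w = w 0 • ![1, 0] + w 1 • ![0, 1] := by
        ext i
        fin_cases i <;> simp
      rw [this]
      exact W.add_mem (W.smul_mem _ h1) (W.smul_mem _ h2)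
    by_cases h0 : v 0 = 0
    · refine key _ (hW (.xa 0) v hv) ?_
      have h1 : v 1 ≠ 0 := fun h1 => hv0 (by ext i; fin_cases i; exacts [h0, h1])
      have he : e (s * l) ≠ 0 := (e.val_isUnit _).ne_zero
      simp [matrixRep_apply, dihHom, Matrix.mulVec, dotProduct, h1, he]
    · exact key v hv h0
  · change (matrixRep (dihHom e s)).character = _
    rw [matrixRep_character]
    ext (i | i) <;> simp [dihHom, dihFun, Matrix.trace]

theorem conj_dihFun [NeZero l] (s : ZMod (2 * l)) (g : QuaternionGroup l) :
    starRingEnd ℂ (dihFun e s g) = dihFun e s g⁻¹ := by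
  rcases g with i | i
  · change _ = dihFun e s (.a (-i))
    simp [dihFun, ← AddChar.map_neg_eq_conj, add_comm]
  · change _ = dihFun e s (.xa (l + i))
    simp [dihFun]

theorem dihFun_mul (s t : ZMod (2 * l)) :
    dihFun e s * dihFun e t = dihFun e (s + t) + dihFun e (s - t) := by
  ext (i | i)
  · simp only [dihFun, Pi.mul_apply, Pi.add_apply, add_mul, neg_mul, neg_add,
      sub_eq_add_neg, AddChar.map_add_eq_mul, mul_add, neg_neg]
    ring
  · simp [dihFun]

theorem linFun_add_linFun_neg {s : ZMod (2 * l)} (hs : s + s = 0) (c : ℂ) :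
    linFun e s c + linFun e s (-c) = dihFun e s := by
  ext (i | i)
  · simp [linFun, dihFun, addChar_neg_of_add_self e hs]
  · simp [linFun, dihFun]

theorem linFun_mul (s t : ZMod (2 * l)) (c d : ℂ) :
    linFun e s c * linFun e t d = linFun e (s + t) (c * d) := by
  ext (i | i)
  · simp [linFun, add_mul, AddChar.map_add_eq_mul]
  · simp [linFun, add_mul, AddChar.map_add_eq_mul]
    ring

theorem linFun_zero_mul_dihFun (c : ℂ) (s : ZMod (2 * l)) :
    linFun e 0 c * dihFun e s = dihFun e s := by
  ext (i | i) <;> simp [linFun, dihFun]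

variable {e}

theorem apply_neg_ne (he : Function.Injective e) {s : ZMod (2 * l)} (hs : s + s ≠ 0) :
    e s ≠ e (-s) := fun h => hs (eq_neg_iff_add_eq_zero.1 (he h))

theorem linFun_one (s : ZMod (2 * l)) (c : ℂ) : linFun e s c 1 = 1 := by
  change e (s * 0) = 1
  simp

theorem dihFun_one (s : ZMod (2 * l)) : dihFun e s 1 = 2 := by
  change e (s * 0) + e (-(s * 0)) = 2
  norm_num

theorem natCast_add_self_ne_zero {a : ℕ} (h0 : 0 < a) (ha : a < l) :
    (a : ZMod (2 * l)) + a ≠ 0 := by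
  rw [← Nat.cast_add, Ne, ZMod.natCast_eq_zero_iff]
  intro h
  have := Nat.le_of_dvd (by omega) h
  omega

end QuaternionGroup

end Characters

/-! ### General properties of coverings -/

namespace IsCharCovering

variable {G Q : Type*} [Group G] [Fintype G] [Mul Q] {f : Q → IrrChar G} (hf : IsCharCovering f)
include hf

/-- The pair (p, q) is itself counted by α, so `f (p * q)` is a constituent of the product of
characters. -/
theorem charInner_ne_zero (p q : Q) : charInner ((f p).1 * (f q).1) (f (p * q)).1 ≠ 0 := by
  have := hf.finite
  have h : charAlpha (f p) (f q) (f (p * q)) ≠ 0 := by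
    rw [← hf.mult, Nat.cast_ne_zero]
    exact Set.ncard_ne_zero_of_mem (a := (p, q)) ⟨rfl, rfl, rfl⟩ (Set.toFinite _)
  exact right_ne_zero_of_mul h

theorem apply_one_ne_zero (θ : IrrChar G) : θ.1 1 ≠ 0 := by
  have := hf.finite
  obtain ⟨q, rfl⟩ := hf.surjective θ
  have h : charWeight (f q) ≠ 0 := by
    rw [← hf.weight, Nat.cast_ne_zero]
    exact Set.ncard_ne_zero_of_mem (a := q) rfl (Set.toFinite _)
  exact fun h0 => h (by rw [charWeight, h0]; norm_num)

theorem exists_mul_of_charInner_ne_zero {θ φ ψ : IrrChar G}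
    (h : charInner (θ.1 * φ.1) ψ.1 ≠ 0) : ∃ p q, f p = θ ∧ f q = φ ∧ f (p * q) = ψ := by
  have h1 : charAlpha θ φ ψ ≠ 0 :=
    mul_ne_zero (mul_ne_zero (mul_ne_zero (hf.apply_one_ne_zero θ) (hf.apply_one_ne_zero φ))
      (hf.apply_one_ne_zero ψ)) h
  rw [← hf.mult, Nat.cast_ne_zero] at h1
  obtain ⟨⟨p, q⟩, hp, hq, hpq⟩ := Set.nonempty_of_ncard_ne_zero h1
  exact ⟨p, q, hp, hq, hpq⟩

theorem eq_of_apply_one_eq_one {p q : Q} (hp : (f p).1 1 = 1) (hq : f q = f p) : q = p := by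
  have h := hf.weight (f p)
  rw [charWeight, hp, one_pow, Nat.cast_eq_one, Set.ncard_eq_one] at h
  obtain ⟨z, hz⟩ := h
  have h1 : p ∈ f ⁻¹' {f p} := rfl
  have h2 : q ∈ f ⁻¹' {f p} := hq
  rw [hz] at h1 h2
  exact Set.mem_singleton_iff.1 h2 |>.trans (Set.mem_singleton_iff.1 h1).symm

end IsCharCovering

/-! ### Layers of a covering of the dicyclic group -/

namespace QuaternionGroup

variable {l : ℕ} [NeZero l] {e : AddChar (ZMod (2 * l)) ℂ}

theorem charInner_dihFun_ne_zero_iff {s : ZMod (2 * l)} (hs : e s ≠ e (-s))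
    (ψ : IrrChar (QuaternionGroup l)) : charInner (dihFun e s) ψ.1 ≠ 0 ↔ ψ.1 = dihFun e s := by
  classical
  obtain ⟨θ, hθ⟩ := exists_dihFun e hs
  rw [← hθ, charInner_irrChar ψ (by rw [hθ]; exact conj_dihFun e s)]
  rw [← IrrChar.ext_iff, eq_comm (a := ψ)]
  simp

theorem charInner_linFun {s : ZMod (2 * l)} {c : ℂ} (hs : s + s = 0) (hc : c * c = e (s * l))
    (ψ : IrrChar (QuaternionGroup l)) [Decidable (ψ.1 = linFun e s c)] :
    charInner (linFun e s c) ψ.1 = if ψ.1 = linFun e s c then 1 else 0 := by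
  classical
  obtain ⟨θ, hθ⟩ := exists_linFun e hs hc
  simp only [← hθ]
  rw [charInner_irrChar ψ (by rw [hθ]; exact conj_linFun e hs hc)]
  simp only [← IrrChar.ext_iff, eq_comm (a := ψ)]

theorem charInner_dihFun_ne_zero_iff_of_add_self {s : ZMod (2 * l)} {c : ℂ} (hs : s + s = 0)
    (hc : c * c = e (s * l)) (ψ : IrrChar (QuaternionGroup l)) :
    charInner (dihFun e s) ψ.1 ≠ 0 ↔ ψ.1 = linFun e s c ∨ ψ.1 = linFun e s (-c) := by
  classical
  rw [← linFun_add_linFun_neg e hs c, charInner_add_left, charInner_linFun hs hc,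
    charInner_linFun hs (by rw [neg_mul_neg, hc])]
  split_ifs <;> simp_all

theorem exists_charInner_dihFun_ne_zero (he : Function.Injective e) (s : ZMod (2 * l)) :
    ∃ ψ : IrrChar (QuaternionGroup l), charInner (dihFun e s) ψ.1 ≠ 0 := by
  by_cases hs : s + s = 0
  · obtain ⟨c, hc⟩ := IsAlgClosed.exists_eq_mul_self (e (s * l))
    obtain ⟨ψ, hψ⟩ := exists_linFun e hs hc.symm
    exact ⟨ψ, (charInner_dihFun_ne_zero_iff_of_add_self hs hc.symm ψ).2 (Or.inl hψ)⟩
  · obtain ⟨ψ, hψ⟩ := exists_dihFun e (apply_neg_ne he hs)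
    exact ⟨ψ, (charInner_dihFun_ne_zero_iff (apply_neg_ne he hs) ψ).2 hψ⟩

/-- Linear and degree-two constituents are treated alike: ψ(x)/ψ(1) determines e(s) + e(-s). -/
theorem two_mul_apply_of_charInner_ne_zero (he : Function.Injective e) {s : ZMod (2 * l)}
    {ψ : IrrChar (QuaternionGroup l)} (h : charInner (dihFun e s) ψ.1 ≠ 0) :
    2 * ψ.1 (a 1) = ψ.1 1 * (e s + e (-s)) := by
  by_cases hs : s + s = 0
  · obtain ⟨c, hc⟩ := IsAlgClosed.exists_eq_mul_self (e (s * l))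
    have h1 : e (-s) = e s := by rw [neg_eq_of_add_eq_zero_left hs]
    rcases (charInner_dihFun_ne_zero_iff_of_add_self hs hc.symm ψ).1 h with h | h <;>
    · rw [h, linFun_one, h1]
      simp only [linFun, mul_one]
      ring
  · rw [(charInner_dihFun_ne_zero_iff (apply_neg_ne he hs) ψ).1 h, dihFun_one]
    simp [dihFun]

/-- Both {e(s), e(-s)} and {e(t), e(-t)} are the roots of one quadratic, with product 1 and the same
sum. This makes the layers disjoint. -/
theorem eq_or_eq_neg_of_charInner_ne_zero (he : Function.Injective e) {s t : ZMod (2 * l)}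
    {ψ : IrrChar (QuaternionGroup l)} (h1 : ψ.1 1 ≠ 0) (hs : charInner (dihFun e s) ψ.1 ≠ 0)
    (ht : charInner (dihFun e t) ψ.1 ≠ 0) : s = t ∨ s = -t := by
  have h := (two_mul_apply_of_charInner_ne_zero he hs).symm.trans
    (two_mul_apply_of_charInner_ne_zero he ht)
  have h2 := mul_left_cancel₀ h1 h
  have e1 : e s * e (-s) = 1 := by rw [← AddChar.map_add_eq_mul, add_neg_cancel, e.map_zero_eq_one]
  have e2 : e t * e (-t) = 1 := by rw [← AddChar.map_add_eq_mul, add_neg_cancel, e.map_zero_eq_one]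
  have h3 : (e s - e t) * (e s - e (-t)) = 0 := by linear_combination e s * h2 - e1 + e2
  rcases mul_eq_zero.1 h3 with h | h
  · exact Or.inl (he (sub_eq_zero.1 h))
  · exact Or.inr (he (sub_eq_zero.1 h))

theorem eq_of_natCast_eq_or_eq_neg {a b : ℕ} (ha : a ≤ l) (hb : b ≤ l)
    (h : (a : ZMod (2 * l)) = b ∨ (a : ZMod (2 * l)) = -b) : a = b := by
  have hl := Nat.pos_of_ne_zero (NeZero.ne l)
  rcases h with h | h
  · rw [ZMod.natCast_eq_natCast_iff'] at h
    rwa [Nat.mod_eq_of_lt (by omega), Nat.mod_eq_of_lt (by omega)] at h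
  · rw [eq_neg_iff_add_eq_zero, ← Nat.cast_add, ZMod.natCast_eq_zero_iff] at h
    rcases Nat.eq_zero_or_pos (a + b) with h0 | h0
    · omega
    · have := Nat.le_of_dvd h0 h
      omega

/-- The union of the fibres over the irreducible characters that occur in `dihFun e a`. -/
def layer {Q : Type*} (e : AddChar (ZMod (2 * l)) ℂ) (f : Q → IrrChar (QuaternionGroup l))
    (a : ℕ) : Set Q :=
  {q | charInner (dihFun e a) (f q).1 ≠ 0}

section Covering

variable {Q : Type*} {f : Q → IrrChar (QuaternionGroup l)}

theorem mem_layer_iff (he : Function.Injective e) {a : ℕ} (h0 : 0 < a) (ha : a < l) {q : Q} :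
    q ∈ layer e f a ↔ (f q).1 = dihFun e a :=
  charInner_dihFun_ne_zero_iff (apply_neg_ne he (natCast_add_self_ne_zero h0 ha)) _

theorem exists_layer_eq (he : Function.Injective e) {a : ℕ} (h0 : 0 < a) (ha : a < l) :
    ∃ θ : IrrChar (QuaternionGroup l), θ.1 = dihFun e a ∧ layer e f a = f ⁻¹' {θ} := by
  obtain ⟨θ, hθ⟩ := exists_dihFun e (apply_neg_ne he (natCast_add_self_ne_zero h0 ha))
  refine ⟨θ, hθ, Set.ext fun q => ?_⟩
  rw [mem_layer_iff he h0 ha, ← hθ, ← IrrChar.ext_iff]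
  rfl

theorem mem_layer_zero_iff {q : Q} :
    q ∈ layer e f 0 ↔ (f q).1 = linFun e 0 1 ∨ (f q).1 = linFun e 0 (-1) := by
  have := charInner_dihFun_ne_zero_iff_of_add_self (e := e) (s := 0) (c := 1) (by simp) (by simp)
    (f q)
  simpa only [layer, Nat.cast_zero, Set.mem_ofPred_eq] using this

variable [Group Q] (hf : IsCharCovering f)
include hf

theorem ncard_layer (he : Function.Injective e) {a : ℕ} (h0 : 0 < a) (ha : a < l) :
    (layer e f a).ncard = 4 := by
  obtain ⟨θ, hθ, h⟩ := exists_layer_eq (f := f) he h0 ha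
  have := hf.weight θ
  rw [h, ← Nat.cast_inj (R := ℂ), this, charWeight, hθ, dihFun_one]
  norm_num

theorem apply_mul_eq_linFun {s t : ZMod (2 * l)} {c d : ℂ} {p q : Q} (hst : s + t + (s + t) = 0)
    (hcd : c * d * (c * d) = e ((s + t) * l)) (hp : (f p).1 = linFun e s c)
    (hq : (f q).1 = linFun e t d) : (f (p * q)).1 = linFun e (s + t) (c * d) := by
  classical
  have h := hf.charInner_ne_zero p q
  rw [hp, hq, linFun_mul, charInner_linFun hst hcd] at h
  by_contra hne
  exact h (if_neg hne)

theorem eq_of_apply_eq_linFun {s : ZMod (2 * l)} {c : ℂ} {p q : Q} (hp : (f p).1 = linFun e s c)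
    (hq : (f q).1 = linFun e s c) : p = q :=
  hf.eq_of_apply_one_eq_one (by rw [hq, linFun_one]) (Subtype.ext (hp.trans hq.symm))

/-- The fibre over the trivial character is a single element, whose square lies in the same fibre;
an idempotent of a group is 1. -/
theorem apply_one : (f 1).1 = linFun e 0 1 := by
  obtain ⟨θ, hθ⟩ := exists_linFun e (s := 0) (c := 1) (by simp) (by simp)
  obtain ⟨q, rfl⟩ := hf.surjective θ
  have h := apply_mul_eq_linFun hf (by simp) (by simp) hθ hθ
  rw [add_zero, mul_one] at h
  have := eq_of_apply_eq_linFun hf h hθ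
  rw [mul_eq_left] at this
  rwa [this] at hθ

theorem exists_layer_zero_eq : ∃ y : Q, layer e f 0 = {1, y} ∧ (f y).1 = linFun e 0 (-1) := by
  obtain ⟨θ, hθ⟩ := exists_linFun e (s := 0) (c := -1) (by simp) (by simp)
  obtain ⟨y, rfl⟩ := hf.surjective θ
  refine ⟨y, Set.ext fun q => ?_, hθ⟩
  rw [mem_layer_zero_iff]
  constructor
  · rintro (h | h)
    · exact Or.inl (eq_of_apply_eq_linFun hf h (apply_one hf))
    · exact Or.inr (eq_of_apply_eq_linFun hf h hθ)
  · rintro (rfl | rfl)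
    · exact Or.inl (apply_one hf)
    · exact Or.inr hθ

theorem ne_one_of_apply_eq_linFun {y : Q} (hy : (f y).1 = linFun e 0 (-1)) : y ≠ 1 := by
  rintro rfl
  rw [apply_one hf (e := e)] at hy
  have h := congrFun hy (.xa 0)
  simp only [linFun, mul_zero, AddChar.map_zero_eq_one, mul_one] at h
  norm_num at h

theorem mul_self_eq_one_of_apply_eq_linFun {y : Q} (hy : (f y).1 = linFun e 0 (-1)) :
    y * y = 1 := by
  have h := apply_mul_eq_linFun hf (by simp) (by simp) hy hy
  rw [add_zero, neg_mul_neg, mul_one] at h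
  exact eq_of_apply_eq_linFun hf h (apply_one hf)

theorem isDicLayering (hl : 2 ≤ l) (he : Function.Injective e) {x y : Q}
    (h0 : layer e f 0 = {1, y}) (hy : (f y).1 = linFun e 0 (-1))
    (h1 : layer e f 1 = ({1, y} : Set Q) * {x, x * y}) (hx : x * x = 1) :
    IsDicLayering l x y (layer e f) where
  two_le := hl
  zero := h0
  one := h1
  y_ne := ne_one_of_apply_eq_linFun hf hy
  y_mul_y := mul_self_eq_one_of_apply_eq_linFun hf hy
  x_mul_x := hx
  left a ha0 hal q hq := by
    have h := hf.charInner_ne_zero y q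
    rwa [hy, (mem_layer_iff he ha0 hal).1 hq, linFun_zero_mul_dihFun] at h
  right a ha0 hal q hq := by
    have h := hf.charInner_ne_zero q y
    rwa [hy, (mem_layer_iff he ha0 hal).1 hq, mul_comm, linFun_zero_mul_dihFun] at h
  ncard a ha0 hal := ncard_layer hf he ha0 hal
  mul a ha p hp q hq := by
    have h := hf.charInner_ne_zero p q
    rw [(mem_layer_iff he (by omega) ha).1 hp, (mem_layer_iff he one_pos (by omega)).1 hq,
      dihFun_mul, charInner_add_left] at h
    push_cast at h
    rw [add_sub_cancel_right, add_assoc, one_add_one_eq_two] at h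
    by_contra hnot
    simp only [layer, Set.mem_ofPred_eq, not_or, not_not, Nat.cast_add, Nat.cast_ofNat] at hnot
    exact h (by rw [hnot.1, hnot.2, add_zero])
  exists_mul a ha := by
    obtain ⟨ψ, hψ⟩ := exists_charInner_dihFun_ne_zero he ((a + 2 : ℕ) : ZMod (2 * l))
    obtain ⟨θ, hθ, hθl⟩ := exists_layer_eq (f := f) he (Nat.succ_pos a) ha
    obtain ⟨φ, hφ, hφl⟩ := exists_layer_eq (f := f) he one_pos (by omega : 1 < l)
    -- Disjointness of layers a and a+2 rules out cancellation between the two summands of the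
    -- product.
    have hψa : charInner (dihFun e a) ψ.1 = 0 := by
      by_contra hne
      have := eq_of_natCast_eq_or_eq_neg (by omega) (by omega)
        (eq_or_eq_neg_of_charInner_ne_zero he (hf.apply_one_ne_zero ψ) hψ hne)
      omega
    obtain ⟨p, q, hp, hq, hpq⟩ :=
      hf.exists_mul_of_charInner_ne_zero (θ := θ) (φ := φ) (ψ := ψ) (by
        rw [hθ, hφ, dihFun_mul, charInner_add_left]
        push_cast at hψ ⊢
        rwa [add_sub_cancel_right, hψa, add_zero, add_assoc, one_add_one_eq_two])
    refine ⟨p, by rw [hθl]; exact hp, q, by rw [hφl]; exact hq, ?_⟩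
    change charInner _ (f (p * q)).1 ≠ 0
    rwa [hpq]
  eq_of_mem a b ha hb q hqa hqb := eq_of_natCast_eq_or_eq_neg ha hb
    (eq_or_eq_neg_of_charInner_ne_zero he (hf.apply_one_ne_zero (f q)) hqa hqb)

theorem layer_nonempty (he : Function.Injective e) (a : ℕ) : (layer e f a).Nonempty := by
  obtain ⟨ψ, hψ⟩ := exists_charInner_dihFun_ne_zero he (a : ZMod (2 * l))
  obtain ⟨q, rfl⟩ := hf.surjective ψ
  exact ⟨q, hψ⟩

/-- A linear character with x ↦ -1 takes at y a value c with c² = (-1)^l = -1, so its square has x ↦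
1, y ↦ -1. -/
theorem mul_self_of_mem_layer (he : Function.Injective e) (hl : Odd l) {y p : Q}
    (hy : (f y).1 = linFun e 0 (-1)) (hp : p ∈ layer e f l) : p * p = y := by
  have hl0 := NeZero.ne l
  have hel : e (l : ZMod (2 * l)) = -1 := by
    have h1 : e (l : ZMod (2 * l)) * e l = 1 := by
      rw [← AddChar.map_add_eq_mul, natCast_add_natCast, e.map_zero_eq_one]
    refine (mul_self_eq_one_iff.1 h1).resolve_left fun h => ?_
    have h2 := he (h.trans e.map_zero_eq_one.symm)
    rw [ZMod.natCast_eq_zero_iff] at h2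
    have := Nat.le_of_dvd (Nat.pos_of_ne_zero hl0) h2
    omega
  have hell : e ((l : ZMod (2 * l)) * l) = -1 := by
    rw [← nsmul_eq_mul, AddChar.map_nsmul_eq_pow, hel, hl.neg_one_pow]
  obtain ⟨c, hc⟩ := IsAlgClosed.exists_eq_mul_self (e ((l : ZMod (2 * l)) * l))
  have hcc : c * c = -1 := hc.symm.trans hell
  have key (d : ℂ) (hd : d * d = -1) (hpd : (f p).1 = linFun e l d) : p * p = y := by
    have h := apply_mul_eq_linFun hf (by simp [natCast_add_natCast])
      (by simp [hd, natCast_add_natCast]) hpd hpd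
    rw [natCast_add_natCast, hd] at h
    exact eq_of_apply_eq_linFun hf h hy
  rcases (charInner_dihFun_ne_zero_iff_of_add_self natCast_add_natCast hc.symm (f p)).1 hp with h | h
  · exact key c hcc h
  · exact key (-c) (by rw [neg_mul_neg, hcc]) h

/-- Layers strictly between 0 and l are single fibres, so balancedness applies to them directly. -/
theorem exists_mul_eq_of_isBalancedMap (he : Function.Injective e) (hb : IsBalancedMap f) {a b c : ℕ}
    (ha0 : 0 < a) (ha : a < l) (hb0 : 0 < b) (hbl : b < l) (hc0 : 0 < c) (hcl : c < l) {q q' : Q}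
    (hq : q ∈ layer e f c) (hq' : q' ∈ layer e f c)
    (h : ∃ s ∈ layer e f a, ∃ t ∈ layer e f b, s * t = q) :
    ∃ s ∈ layer e f a, ∃ t ∈ layer e f b, s * t = q' := by
  have := hf.finite
  obtain ⟨θ, -, hθ⟩ := exists_layer_eq (f := f) he ha0 ha
  obtain ⟨φ, -, hφ⟩ := exists_layer_eq (f := f) he hb0 hbl
  rw [mem_layer_iff he hc0 hcl] at hq hq'
  obtain ⟨s, hs, t, ht, hst⟩ := h
  have h1 := hb θ φ q q' (Subtype.ext (hq.trans hq'.symm))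
  have h2 : prodMult (f ⁻¹' {θ}) (f ⁻¹' {φ}) q ≠ 0 := by
    rw [hθ] at hs
    rw [hφ] at ht
    exact Set.ncard_ne_zero_of_mem (a := (s, t)) ⟨hs, ht, hst⟩ (Set.toFinite _)
  rw [h1] at h2
  obtain ⟨⟨s, t⟩, hs, ht, hst⟩ := Set.nonempty_of_ncard_ne_zero h2
  rw [hθ, hφ]
  exact ⟨s, hs, t, ht, hst⟩

end Covering

end QuaternionGroup

/-! ### Cosets of {1, y} and the conclusion -/

theorem ncard_pair_mul_le {Q : Type*} [Group Q] (y u v : Q) :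
    (({1, y} : Set Q) * {u, v}).ncard ≤ 4 := by
  have h := Set.natCard_mul_le (s := ({1, y} : Set Q)) (t := {u, v})
  have h1 := Set.ncard_insert_le (1 : Q) {y}
  have h2 := Set.ncard_insert_le u {v}
  rw [Set.ncard_singleton] at h1 h2
  exact h.trans (Nat.mul_le_mul h1 h2)

theorem ncard_pair_mul_singleton_le {Q : Type*} [Group Q] (y u : Q) :
    (({1, y} : Set Q) * {u}).ncard ≤ 2 := by
  have h := Set.natCard_mul_le (s := ({1, y} : Set Q)) (t := {u})
  have h1 := Set.ncard_insert_le (1 : Q) {y}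
  rw [Set.ncard_singleton] at h1
  exact h.trans (Nat.mul_le_mul h1 (Set.ncard_singleton u).le)

/-- If two right cosets `{1, y} u ≠ {1, y} v` satisfy `u u, u v ∈ {1, y}`, then `u` is an involution
and `v = u y`. -/
theorem sq_eq_one_and_eq_mul_of_mem_pair {Q : Type*} [Group Q] {y u v : Q} (hy : y * y = 1)
    (hcard : 2 < (({1, y} : Set Q) * {u, v}).ncard) (huu : u * u ∈ ({1, y} : Set Q))
    (huv : u * v ∈ ({1, y} : Set Q)) : u * u = 1 ∧ v = u * y := by
  have hvu : v ≠ u := by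
    rintro rfl
    rw [Set.pair_eq_singleton] at hcard
    exact absurd (ncard_pair_mul_singleton_le y v) (not_le.2 hcard)
  have hvy : v ≠ y * u := by
    rintro rfl
    have : (({1, y} : Set Q) * {u, y * u}) = {1, y} * {u} := by
      ext g
      simp only [Set.mem_mul, Set.mem_insert_iff, Set.mem_singleton_iff]
      constructor
      · rintro ⟨a, rfl | rfl, b, rfl | rfl, rfl⟩
        · exact ⟨1, by simp⟩
        · exact ⟨y, by simp⟩
        · exact ⟨a, by simp⟩
        · exact ⟨1, by simp [← mul_assoc, hy]⟩
      · rintro ⟨a, ha, b, rfl, rfl⟩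
        exact ⟨a, ha, b, by simp⟩
    rw [this] at hcard
    exact absurd (ncard_pair_mul_singleton_le y u) (not_le.2 hcard)
  rcases huu with huu | huu
  · refine ⟨huu, ?_⟩
    rcases huv with huv | huv
    · exact absurd (mul_left_cancel (huv.trans huu.symm)) hvu
    · rw [← huv, ← mul_assoc, huu, one_mul]
  -- Here u² = y: if uv = 1 then v = u⁻¹ = yu, and if uv = y then v = u, both excluded.
  · rw [Set.mem_singleton_iff] at huu
    rcases huv with huv | huv
    · refine absurd ?_ hvy
      apply mul_left_cancel (a := u)
      rw [huv, ← huu, mul_assoc, ← mul_assoc, huu, hy]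
    · exact absurd (mul_left_cancel (huv.trans huu.symm)) hvu

theorem mainTheorem5 (l : ℕ) [NeZero l] (hl : 2 ≤ l)
    (ω : ℂ) (hω : IsPrimitiveRoot ω (2 * l)) {Q : Type*} [Group Q]
    (f : Q → IrrChar (QuaternionGroup l)) (hf : IsCharCovering f)
    (x₀ y₀ x₁ y₁ : Q) (hc : IsDicChoice ω f x₀ y₀ x₁ y₁) :
    (Odd l → ¬ DicCaseB ω f x₀ y₀ x₁ y₁) ∧
    (Even l → IsBalancedMap f → x₁ ^ 2 = 1 → x₁ * y₁ = y₀ → y₁ ^ 2 ∉ ({x₀, y₀} : Set Q) →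
      Nonempty (Q ≃* DihedralGroup (2 * l))) := by
  let e : AddChar (ZMod (2 * l)) ℂ := AddChar.zmodChar (2 * l) hω.pow_eq_one
  have he_apply (i : ZMod (2 * l)) : e i = ω ^ i.val := AddChar.zmodChar_apply hω.pow_eq_one i
  have he : Function.Injective e := fun i j hij =>
    ZMod.val_injective _ (hω.pow_inj (ZMod.val_lt i) (ZMod.val_lt j) hij)
  obtain ⟨y, hy0, hy⟩ := QuaternionGroup.exists_layer_zero_eq (e := e) hf
  have hx₀ : x₀ = 1 := mul_eq_right.1 hc.mul_eq
  have hyy : y * y = 1 := QuaternionGroup.mul_self_eq_one_of_apply_eq_linFun hf hy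
  obtain rfl : y = y₀ := by
    have h : y ∈ dicS ω f 0 := by
      intro i
      rw [hy]
      simp [QuaternionGroup.linFun]
    rw [hc.S_zero, hx₀] at h
    exact h.resolve_left (QuaternionGroup.ne_one_of_apply_eq_linFun hf hy)
  subst hx₀
  have hlayer : QuaternionGroup.layer e f 1 = ({1, y} : Set Q) * {x₁, y₁} := by
    have := hf.finite
    rw [← hc.S_one]
    -- One inclusion suffices: the layer has four elements, and `dicS ω f 1`, a product of two
    -- pairs, has at most four.
    refine Set.eq_of_subset_of_ncard_le ?_ ?_ (Set.toFinite _)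
    · intro q hq i
      have hne : ((1 : ℕ) : ZMod (2 * l)) ≠ -((1 : ℕ) : ZMod (2 * l)) := fun h =>
        QuaternionGroup.natCast_add_self_ne_zero one_pos hl (eq_neg_iff_add_eq_zero.1 h)
      rw [(QuaternionGroup.mem_layer_iff he one_pos hl).1 hq, Finset.sum_pair hne]
      simp only [QuaternionGroup.dihFun, he_apply, neg_mul]
    · rw [QuaternionGroup.ncard_layer hf he one_pos hl, hc.S_one]
      exact ncard_pair_mul_le _ _ _
  have hcard : Nat.card Q = 4 * l := by rw [hf.card_eq, QuaternionGroup.card]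
  refine ⟨fun hodd ⟨hB1, hB2, _⟩ => ?_, fun _ hbal hx hxy _ => ?_⟩
  · obtain ⟨hxx, rfl⟩ := sq_eq_one_and_eq_mul_of_mem_pair hyy
      (by rw [← hlayer, QuaternionGroup.ncard_layer hf he one_pos hl]; norm_num) hB1 hB2
    exact (QuaternionGroup.isDicLayering hf hl he hy0 hy hlayer hxx).false_of_odd hodd hcard
      (fun p hp => QuaternionGroup.mul_self_of_mem_layer hf he hodd hy hp)
      (QuaternionGroup.layer_nonempty hf he l)
  · rw [pow_two] at hx
    obtain rfl : y₁ = x₁ * y := by rw [← hxy, ← mul_assoc, hx, one_mul]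
    refine (QuaternionGroup.isDicLayering hf hl he hy0 hy hlayer hx).nonempty_mulEquiv hcard ?_
    intro a ha q hq q' hq' h
    exact QuaternionGroup.exists_mul_eq_of_isBalancedMap hf he hbal (Nat.succ_pos a) (by omega)
      one_pos (by omega) (Nat.succ_pos _) ha hq hq' h
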